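/- Let $E$ be a second-countable topological space (not assumed Hausdorff) which is a $k_\omega$-space, i.e. there is a sequence $(K_i)_{i\in\mathbb N}$ of compact subsets of $E$ with $\bigcup_i K_i=E$ such that a subset $O\subseteq E$ is open if and only if $O\cap K_i$ is open in $K_i$ (for the subspace topology) for every $i$. Let $\le$ be a closed preorder on $E$, i.e. a reflexive and transitive relation whose graph $\{(x,y): x\le y\}$ is closed in $E\times E$. Call $f:E\to\mathbb R$ a utility if $x\le y$ implies $f(x)\le f(y)$, and $x\le y$ together with $y\not\le x$ implies $f(x)<f(y)$. Then there is a countable family $(u_k)_{k\in\mathbb N}$ of continuous utilities $u_k:E\to[0,1]$ such that, for all $x,y\in E$, $$x\le y\iff u_k(x)\le u_k(y)\ \text{ for every } k .$$ -/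

import Mathlib

/-- A `k_ω`-space (no separation axiom is assumed): there is a sequence of compact subsets that
covers the space, such that a set is open exactly when its trace on each member of the sequence is
open in that member for the subspace topology. -/
class KOmegaSpace (E : Type*) [TopologicalSpace E] : Prop where
  exists_admissible : ∃ K : ℕ → Set E, (∀ i, IsCompact (K i)) ∧ (⋃ i, K i) = Set.univ ∧
    ∀ O : Set E, IsOpen O ↔ ∀ i, IsOpen ((Subtype.val : K i → E) ⁻¹' O)

/-- A utility on a preordered set: an isotone real function that is strictly increasing along
strict comparisons. -/
structure IsUtility {E : Type*} [Preorder E] (f : E → ℝ) : Prop where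
  isotone : ∀ x y : E, x ≤ y → f x ≤ f y
  strict : ∀ x y : E, x ≤ y → ¬ y ≤ x → f x < f y

open Set Filter Topology

/-! Compactness replaces Hausdorff separation: the tube lemma, applied to the closed graph, makes
lower and upper hulls of compact sets closed, so compact spaces are normally preordered. A
`k_ω`-space inherits this (`KOmegaSpace.normallyPreordered`): the separating sets are built along an
increasing exhaustion `K n`, with compact sets carrying each stage into the next. An order version
of Urysohn's lemma then gives an isotone continuous function for each pair with `¬ x ≤ y`, and the
Lindelöf property of subsets of `E × E` leaves countably many `f k`. A weighted sum `g` of these is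
a utility. Convex combinations of `f k` with `g` are utilities too, and they tend to `f k` as the
weight of `g` tends to zero, so they still determine the preorder. -/

/-- A preordered topological space is *normally preordered* if disjoint closed lower and closed
upper sets have disjoint open neighbourhoods that are lower, respectively upper. -/
def NormallyPreordered (E : Type*) [TopologicalSpace E] [Preorder E] : Prop :=
  ∀ A B : Set E, IsClosed A → IsLowerSet A → IsClosed B → IsUpperSet B → Disjoint A B →
    ∃ U V : Set E, IsOpen U ∧ IsLowerSet U ∧ IsOpen V ∧ IsUpperSet V ∧ A ⊆ U ∧ B ⊆ V ∧
      Disjoint U V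

/-! ### Normality: compact spaces, then `k_ω`-spaces. -/

section Normality

variable {E : Type*} [TopologicalSpace E] [Preorder E]

theorem IsCompact.isClosed_coe_upperClosure [OrderClosedTopology E] {K : Set E}
    (hK : IsCompact K) : IsClosed (upperClosure K : Set E) := by
  refine isOpen_compl_iff.1 (isOpen_iff_mem_nhds.2 fun x hx => ?_)
  have hsub : K ×ˢ {x} ⊆ {p : E × E | p.1 ≤ p.2}ᶜ := by
    rintro ⟨a, b⟩ ⟨ha, rfl⟩ hab
    exact hx (mem_upperClosure.2 ⟨a, ha, hab⟩)
  obtain ⟨u, v, -, hv, hKu, hxv, huv⟩ := generalized_tube_lemma hK isCompact_singleton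
    (isClosed_le continuous_fst continuous_snd).isOpen_compl hsub
  filter_upwards [hv.mem_nhds (hxv rfl)] with y hy hyK
  obtain ⟨a, ha, hay⟩ := mem_upperClosure.1 hyK
  exact huv (mk_mem_prod (hKu ha) hy) hay

theorem IsCompact.isClosed_coe_lowerClosure [OrderClosedTopology E] {K : Set E}
    (hK : IsCompact K) : IsClosed (lowerClosure K : Set E) :=
  IsCompact.isClosed_coe_upperClosure (E := Eᵒᵈ) hK

theorem normallyPreordered_of_compactSpace [OrderClosedTopology E] [CompactSpace E] :
    NormallyPreordered E := by
  intro A B hA hAl hB hBu hAB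
  have hsub : A ×ˢ B ⊆ {p : E × E | p.2 ≤ p.1}ᶜ := by
    rintro ⟨a, b⟩ ⟨ha, hb⟩ hab
    exact disjoint_left.1 hAB ha (hBu hab hb)
  obtain ⟨u, v, hu, hv, hAu, hBv, huv⟩ := generalized_tube_lemma hA.isCompact hB.isCompact
    (isClosed_le continuous_snd continuous_fst).isOpen_compl hsub
  -- The largest lower subset of `u` and the largest upper subset of `v`; they are open because
  -- hulls of compact sets are closed.
  refine ⟨(upperClosure uᶜ : Set E)ᶜ, (lowerClosure vᶜ : Set E)ᶜ,
    hu.isClosed_compl.isCompact.isClosed_coe_upperClosure.isOpen_compl,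
    (upperClosure uᶜ).upper.compl,
    hv.isClosed_compl.isCompact.isClosed_coe_lowerClosure.isOpen_compl,
    (lowerClosure vᶜ).lower.compl, ?_, ?_, ?_⟩
  · rintro a ha hau
    obtain ⟨b, hb, hba⟩ := mem_upperClosure.1 hau
    exact hb (hAu (hAl hba ha))
  · rintro a ha hav
    obtain ⟨b, hb, hab⟩ := mem_lowerClosure.1 hav
    exact hb (hBv (hBu hab ha))
  · refine disjoint_left.2 fun x hxu hxv => ?_
    have h1 : x ∈ u := by_contra fun h => hxu (subset_upperClosure h)
    have h2 : x ∈ v := by_contra fun h => hxv (subset_lowerClosure h)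
    exact huv (mk_mem_prod h1 h2) le_rfl

/-- In a normally preordered space, disjoint closed lower and closed upper sets have disjoint
neighbourhoods which are themselves closed lower, respectively closed upper. -/
theorem NormallyPreordered.exists_closed_neighbourhoods (hE : NormallyPreordered E) {A B : Set E}
    (hA : IsClosed A) (hAl : IsLowerSet A) (hB : IsClosed B) (hBu : IsUpperSet B)
    (hAB : Disjoint A B) :
    ∃ U V C D : Set E, IsOpen U ∧ IsLowerSet U ∧ IsOpen V ∧ IsUpperSet V ∧
      IsClosed C ∧ IsLowerSet C ∧ IsClosed D ∧ IsUpperSet D ∧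
      A ⊆ U ∧ U ⊆ C ∧ B ⊆ V ∧ V ⊆ D ∧ Disjoint C D := by
  obtain ⟨U, W, hU, hUl, hW, hWu, hAU, hBW, hUW⟩ := hE A B hA hAl hB hBu hAB
  obtain ⟨T, V, hT, hTl, hV, hVu, hWT, hBV, hTV⟩ := hE Wᶜ B hW.isClosed_compl hWu.compl hB hBu
    (disjoint_left.2 fun x hx hxB => hx (hBW hxB))
  exact ⟨U, V, Wᶜ, Tᶜ, hU, hUl, hV, hVu, hW.isClosed_compl, hWu.compl, hT.isClosed_compl,
    hTl.compl, hAU, hUW.subset_compl_right, hBV, hTV.symm.subset_compl_right,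
    disjoint_left.2 fun x hx hxT => hxT (hWT hx)⟩

/-- Separation inside a compact subset of the traces of a closed lower and a closed upper set. -/
theorem IsCompact.exists_separation [OrderClosedTopology E] {K : Set E} (hK : IsCompact K)
    {A B : Set E} (hA : IsClosed A) (hAl : IsLowerSet A) (hB : IsClosed B) (hBu : IsUpperSet B)
    (hAB : Disjoint A B) :
    ∃ U V C D : Set E, IsOpen U ∧ IsOpen V ∧ IsCompact C ∧ IsCompact D ∧ C ⊆ K ∧ D ⊆ K ∧
      (∀ x ∈ K, ∀ y ∈ U ∩ K, x ≤ y → x ∈ U) ∧ (∀ x ∈ K, ∀ y ∈ V ∩ K, y ≤ x → x ∈ V) ∧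
      A ∩ K ⊆ U ∧ U ∩ K ⊆ C ∧ B ∩ K ⊆ V ∧ V ∩ K ⊆ D ∧ ∀ c ∈ C, ∀ d ∈ D, ¬ d ≤ c := by
  have : CompactSpace K := isCompact_iff_compactSpace.1 hK
  obtain ⟨U, V, C, D, hU, hUl, hV, hVu, hC, hCl, hD, hDu, hAU, hUC, hBV, hVD, hCD⟩ :=
    (normallyPreordered_of_compactSpace (E := K)).exists_closed_neighbourhoods
      (A := Subtype.val ⁻¹' A) (B := Subtype.val ⁻¹' B)
      (hA.preimage continuous_subtype_val) (fun a b hab ha => hAl hab ha)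
      (hB.preimage continuous_subtype_val) (fun a b hab ha => hBu hab ha)
      (hAB.preimage _)
  obtain ⟨U, hUo, rfl⟩ := isOpen_induced_iff.1 hU
  obtain ⟨V, hVo, rfl⟩ := isOpen_induced_iff.1 hV
  refine ⟨U, V, Subtype.val '' C, Subtype.val '' D, hUo, hVo,
    hC.isCompact.image continuous_subtype_val, hD.isCompact.image continuous_subtype_val,
    Subtype.coe_image_subset K C, Subtype.coe_image_subset K D, ?_, ?_, ?_, ?_, ?_, ?_, ?_⟩
  · intro x hx y hy hxy
    exact hUl (a := ⟨y, hy.2⟩) (b := ⟨x, hx⟩) hxy hy.1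
  · intro x hx y hy hxy
    exact hVu (a := ⟨y, hy.2⟩) (b := ⟨x, hx⟩) hxy hy.1
  · exact fun x hx => hAU (a := ⟨x, hx.2⟩) hx.1
  · exact fun x hx => ⟨⟨x, hx.2⟩, hUC hx.1, rfl⟩
  · exact fun x hx => hBV (a := ⟨x, hx.2⟩) hx.1
  · exact fun x hx => ⟨⟨x, hx.2⟩, hVD hx.1, rfl⟩
  · rintro _ ⟨c, hc, rfl⟩ _ ⟨d, hd, rfl⟩ hdc
    exact disjoint_left.1 hCD hc (hDu hdc hd)

theorem KOmegaSpace.exists_monotone_admissible (E : Type*) [TopologicalSpace E] [KOmegaSpace E] :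
    ∃ K : ℕ → Set E, Monotone K ∧ (∀ i, IsCompact (K i)) ∧ (∀ x, ∃ i, x ∈ K i) ∧
      ∀ O : Set E, (∀ i, IsOpen ((Subtype.val : K i → E) ⁻¹' O)) → IsOpen O := by
  obtain ⟨K, hK, hcov, hO⟩ := KOmegaSpace.exists_admissible (E := E)
  refine ⟨accumulate K, monotone_accumulate, isCompact_accumulate hK, fun x => ?_,
    fun O h => (hO O).2 fun i => ?_⟩
  · obtain ⟨i, hi⟩ := mem_iUnion.1 (hcov ▸ mem_univ x)
    exact ⟨i, subset_accumulate hi⟩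
  · exact (h i).preimage (continuous_inclusion (subset_accumulate (s := K) (x := i)))

/-- On `K m` the terms with `n < m` are absorbed by later ones, and for `n ≥ m` intersecting with `K
n` changes nothing. -/
theorem isOpen_iUnion_inter_of_monotone {X : Type*} [TopologicalSpace X] {K : ℕ → Set X}
    (hKm : Monotone K)
    (hKopen : ∀ O : Set X, (∀ i, IsOpen ((Subtype.val : K i → X) ⁻¹' O)) → IsOpen O)
    {W : ℕ → Set X} (hW : ∀ n, IsOpen (W n)) (hWm : Monotone fun n => W n ∩ K n) :
    IsOpen (⋃ n, W n ∩ K n) := by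
  refine hKopen _ fun m => isOpen_induced_iff.2
    ⟨⋃ n ≥ m, W n, isOpen_biUnion fun n _ => hW n, ?_⟩
  ext ⟨x, hx⟩
  simp only [mem_preimage, mem_iUnion, exists_prop]
  constructor
  · rintro ⟨n, hn, hxn⟩
    exact ⟨n, hxn, hKm hn hx⟩
  · rintro ⟨n, hxn⟩
    exact ⟨max m n, le_max_left m n, (hWm (le_max_right m n) hxn).1⟩

theorem exists_seq_of_step {S : Type*} (R : ℕ → S → S → Prop) (s₀ : S)
    (h : ∀ n s, ∃ t, R n s t) : ∃ f : ℕ → S, f 0 = s₀ ∧ ∀ n, R n (f n) (f (n + 1)) := by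
  choose g hg using h
  exact ⟨fun n => Nat.rec s₀ g n, rfl, fun n => hg n _⟩

/-- A `k_ω`-space with a closed preorder is normally preordered. -/
theorem KOmegaSpace.normallyPreordered [KOmegaSpace E] [OrderClosedTopology E] :
    NormallyPreordered E := by
  intro A B hA hAl hB hBu hAB
  obtain ⟨K, hKm, hK, hcov, hopen⟩ := KOmegaSpace.exists_monotone_admissible E
  -- Forbidding `b ≤ a`, rather than mere equality, keeps the lower and upper hulls disjoint, so
  -- separation can be repeated on the next compact set.
  let S := {p : Set E × Set E // IsCompact p.1 ∧ IsCompact p.2 ∧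
    ∀ a ∈ A ∪ p.1, ∀ b ∈ B ∪ p.2, ¬ b ≤ a}
  let R : ℕ → S → S → Prop := fun n s t => ∃ U V : Set E, IsOpen U ∧ IsOpen V ∧
    t.1.1 ⊆ K n ∧ t.1.2 ⊆ K n ∧
    (∀ x ∈ K n, ∀ y ∈ U ∩ K n, x ≤ y → x ∈ U) ∧ (∀ x ∈ K n, ∀ y ∈ V ∩ K n, y ≤ x → x ∈ V) ∧
    (A ∪ s.1.1) ∩ K n ⊆ U ∧ U ∩ K n ⊆ t.1.1 ∧ (B ∪ s.1.2) ∩ K n ⊆ V ∧ V ∩ K n ⊆ t.1.2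
  have hstep : ∀ n s, ∃ t, R n s t := by
    rintro n ⟨⟨P, Q⟩, hP, hQ, hPQ⟩
    have hdisj : Disjoint (A ∪ lowerClosure P) (B ∪ upperClosure Q) := by
      refine disjoint_left.2 fun x hx hx' => ?_
      obtain ⟨a, ha, hxa⟩ : ∃ a ∈ A ∪ P, x ≤ a := by
        rcases hx with hx | ⟨a, ha, hxa⟩
        exacts [⟨x, Or.inl hx, le_rfl⟩, ⟨a, Or.inr ha, hxa⟩]
      obtain ⟨b, hb, hbx⟩ : ∃ b ∈ B ∪ Q, b ≤ x := by
        rcases hx' with hx | ⟨a, ha, hxa⟩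
        exacts [⟨x, Or.inl hx, le_rfl⟩, ⟨a, Or.inr ha, hxa⟩]
      exact hPQ a ha b hb (hbx.trans hxa)
    obtain ⟨U, V, C, D, hU, hV, hC, hD, hCK, hDK, hUl, hVu, hAU, hUC, hBV, hVD, hCD⟩ :=
      (hK n).exists_separation (hA.union hP.isClosed_coe_lowerClosure)
        (hAl.union (lowerClosure P).lower) (hB.union hQ.isClosed_coe_upperClosure)
        (hBu.union (upperClosure Q).upper) hdisj
    have hAC : A ∩ K n ⊆ C := fun x hx => hUC ⟨hAU ⟨Or.inl hx.1, hx.2⟩, hx.2⟩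
    have hBD : B ∩ K n ⊆ D := fun x hx => hVD ⟨hBV ⟨Or.inl hx.1, hx.2⟩, hx.2⟩
    refine ⟨⟨(C, D), hC, hD, ?_⟩, U, V, hU, hV, hCK, hDK, hUl, hVu, ?_, hUC, ?_, hVD⟩
    · rintro a (ha | ha) b (hb | hb) hba
      · exact disjoint_left.1 hAB ha (hBu hba hb)
      · exact hCD b (hAC ⟨hAl hba ha, hDK hb⟩) b hb le_rfl
      · exact hCD a ha a (hBD ⟨hBu hba hb, hCK ha⟩) le_rfl
      · exact hCD a ha b hb hba
    · exact (inter_subset_inter_left _ (union_subset_union_right _ subset_lowerClosure)).trans hAU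
    · exact (inter_subset_inter_left _ (union_subset_union_right _ subset_upperClosure)).trans hBV
  have h₀ : ∀ a ∈ A ∪ ∅, ∀ b ∈ B ∪ ∅, ¬ b ≤ a := by
    simp only [union_empty]
    exact fun a ha b hb hba => disjoint_left.1 hAB ha (hBu hba hb)
  obtain ⟨s, -, hR⟩ := exists_seq_of_step R
    ⟨(∅, ∅), isCompact_empty, isCompact_empty, h₀⟩ hstep
  choose U V hU hV hsK₁ hsK₂ hUl hVu hAU hUs hBV hVs using hR
  -- The trace at stage `n` lies in the compact set whose part in `K (n + 1)` the next stage must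
  -- contain.
  have hUm : Monotone fun n => U n ∩ K n := monotone_nat_of_le_succ fun n x hx =>
    have hxK := hKm n.le_succ hx.2
    ⟨hAU (n + 1) ⟨Or.inr (hUs n hx), hxK⟩, hxK⟩
  have hVm : Monotone fun n => V n ∩ K n := monotone_nat_of_le_succ fun n x hx =>
    have hxK := hKm n.le_succ hx.2
    ⟨hBV (n + 1) ⟨Or.inr (hVs n hx), hxK⟩, hxK⟩
  refine ⟨⋃ n, U n ∩ K n, ⋃ n, V n ∩ K n, isOpen_iUnion_inter_of_monotone hKm hopen hU hUm, ?_,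
    isOpen_iUnion_inter_of_monotone hKm hopen hV hVm, ?_, ?_, ?_, ?_⟩
  · intro y x hxy hy
    obtain ⟨n, hn⟩ := mem_iUnion.1 hy
    obtain ⟨m, hm⟩ := hcov x
    have hxK := hKm (le_max_right n m) hm
    exact mem_iUnion.2 ⟨max n m, hUl _ x hxK y (hUm (le_max_left n m) hn) hxy, hxK⟩
  · intro y x hxy hy
    obtain ⟨n, hn⟩ := mem_iUnion.1 hy
    obtain ⟨m, hm⟩ := hcov x
    have hxK := hKm (le_max_right n m) hm
    exact mem_iUnion.2 ⟨max n m, hVu _ x hxK y (hVm (le_max_left n m) hn) hxy, hxK⟩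
  · intro x hx
    obtain ⟨m, hm⟩ := hcov x
    exact mem_iUnion.2 ⟨m, hAU m ⟨Or.inl hx, hm⟩, hm⟩
  · intro x hx
    obtain ⟨m, hm⟩ := hcov x
    exact mem_iUnion.2 ⟨m, hBV m ⟨Or.inl hx, hm⟩, hm⟩
  · refine disjoint_left.2 fun x hxU hxV => ?_
    obtain ⟨n, hn⟩ := mem_iUnion.1 hxU
    obtain ⟨m, hm⟩ := mem_iUnion.1 hxV
    exact (s (max n m + 1)).2.2.2 x (Or.inr (hUs _ (hUm (le_max_left n m) hn)))
      x (Or.inr (hVs _ (hVm (le_max_right n m) hm))) le_rfl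

end Normality

/-! ### The Urysohn–Nachbin construction. -/

/-- A closed lower set together with an open lower neighbourhood of it. These pairs drive the
inductive construction in the Urysohn–Nachbin lemma, which follows `Urysohns.CU`. -/
structure LowerPair (E : Type*) [TopologicalSpace E] [Preorder E] where
  /-- The inner closed lower set. -/
  C : Set E
  /-- The outer open lower set. -/
  U : Set E
  closed_C : IsClosed C
  lower_C : IsLowerSet C
  open_U : IsOpen U
  lower_U : IsLowerSet U
  subset : C ⊆ U

namespace LowerPair

variable {E : Type*} [TopologicalSpace E] [Preorder E]

theorem exists_between (hE : NormallyPreordered E) (c : LowerPair E) :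
    ∃ l r : LowerPair E, l.C = c.C ∧ l.U ⊆ r.C ∧ r.U = c.U := by
  obtain ⟨U, V, hU, hUl, hV, hVu, hCU, hUV, h⟩ := hE c.C c.Uᶜ c.closed_C c.lower_C
    c.open_U.isClosed_compl c.lower_U.compl (disjoint_left.2 fun x hx hxU => hxU (c.subset hx))
  exact ⟨⟨c.C, U, c.closed_C, c.lower_C, hU, hUl, hCU⟩,
    ⟨Vᶜ, c.U, hV.isClosed_compl, hVu.compl, c.open_U, c.lower_U, compl_subset_comm.1 hUV⟩,
    rfl, h.subset_compl_right, rfl⟩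

/-- The inner half of a lower pair in a normally preordered space. -/
noncomputable def left (hE : NormallyPreordered E) (c : LowerPair E) : LowerPair E :=
  (c.exists_between hE).choose

/-- The outer half of a lower pair in a normally preordered space. -/
noncomputable def right (hE : NormallyPreordered E) (c : LowerPair E) : LowerPair E :=
  (c.exists_between hE).choose_spec.choose

variable (hE : NormallyPreordered E) (c : LowerPair E)

theorem left_C : (c.left hE).C = c.C :=
  (c.exists_between hE).choose_spec.choose_spec.1

theorem left_U_subset_right_C : (c.left hE).U ⊆ (c.right hE).C :=
  (c.exists_between hE).choose_spec.choose_spec.2.1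

theorem right_U : (c.right hE).U = c.U :=
  (c.exists_between hE).choose_spec.choose_spec.2.2

theorem left_U_subset : (c.left hE).U ⊆ c.U :=
  (c.left_U_subset_right_C hE).trans ((c.right hE).subset.trans (c.right_U hE).subset)

theorem subset_right_C : c.C ⊆ (c.right hE).C :=
  (c.left_C hE).symm.subset.trans ((c.left hE).subset.trans (c.left_U_subset_right_C hE))

/-- The `n`-th approximation to an isotone continuous function which is `0` on `c.C` and `1`
outside `c.U`. -/
noncomputable def approx : ℕ → LowerPair E → E → ℝ
  | 0, c, x => indicator c.Uᶜ 1 x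
  | n + 1, c, x => (approx n (c.left hE) x + approx n (c.right hE) x) / 2

theorem approx_of_mem_C (n : ℕ) {x : E} (hx : x ∈ c.C) : approx hE n c x = 0 := by
  induction n generalizing c with
  | zero => exact indicator_of_notMem (fun hU : x ∈ c.Uᶜ => hU (c.subset hx)) _
  | succ n ih =>
    rw [approx, ih _ ((c.left_C hE).symm ▸ hx), ih _ (c.subset_right_C hE hx)]
    norm_num

theorem approx_of_notMem_U (n : ℕ) {x : E} (hx : x ∉ c.U) : approx hE n c x = 1 := by
  induction n generalizing c with
  | zero => exact indicator_of_mem (mem_compl hx) _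
  | succ n ih =>
    rw [approx, ih _ fun h => hx (c.left_U_subset hE h), ih _ ((c.right_U hE).symm ▸ hx)]
    norm_num

theorem approx_mem_Icc (n : ℕ) (x : E) : approx hE n c x ∈ Icc (0 : ℝ) 1 := by
  induction n generalizing c with
  | zero =>
    by_cases hx : x ∈ c.U
    · simp [approx, hx]
    · simp [approx, hx]
  | succ n ih =>
    have h₁ := ih (c.left hE)
    have h₂ := ih (c.right hE)
    rw [approx]
    constructor <;> linarith [h₁.1, h₁.2, h₂.1, h₂.2]

theorem monotone_approx (n : ℕ) : Monotone (approx hE n c) := by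
  induction n generalizing c with
  | zero =>
    intro x y hxy
    by_cases hy : y ∈ c.U
    · simp [approx, hy, c.lower_U hxy hy]
    · rw [approx_of_notMem_U hE c 0 hy]
      exact (approx_mem_Icc hE c 0 x).2
  | succ n ih =>
    intro x y hxy
    rw [approx, approx]
    linarith [ih (c.left hE) hxy, ih (c.right hE) hxy]

variable {c} in
theorem approx_le_approx_of_U_subset_C {d : LowerPair E} (h : c.U ⊆ d.C) (n m : ℕ) (x : E) :
    approx hE m d x ≤ approx hE n c x := by
  by_cases hx : x ∈ c.U
  · rw [approx_of_mem_C hE d m (h hx)]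
    exact (approx_mem_Icc hE c n x).1
  · rw [approx_of_notMem_U hE c n hx]
    exact (approx_mem_Icc hE d m x).2

theorem approx_mem_Icc_right_left (n : ℕ) (x : E) :
    approx hE n c x ∈ Icc (approx hE n (c.right hE) x) (approx hE n (c.left hE) x) := by
  induction n generalizing c with
  | zero =>
    refine ⟨by simp only [approx, right_U, le_refl], ?_⟩
    by_cases hx : x ∈ (c.left hE).U
    · simp [approx, hx, c.left_U_subset hE hx]
    · rw [approx_of_notMem_U hE _ 0 hx]
      exact (approx_mem_Icc hE c 0 x).2
  | succ n ih =>
    have h₁ := ih (c.left hE)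
    have h₂ := ih (c.right hE)
    have h₃ := approx_le_approx_of_U_subset_C hE (c.left_U_subset_right_C hE) n n x
    -- Comparisons across the two halves come from nesting, since `ih` only compares within one
    -- half.
    have h₄ := approx_le_approx_of_U_subset_C hE
      (((c.left hE).right_U hE).subset.trans (c.left_U_subset_right_C hE)) n n x
    have h₅ := approx_le_approx_of_U_subset_C hE
      ((c.left_U_subset_right_C hE).trans ((c.right hE).left_C hE).symm.subset) n n x
    simp only [approx, mem_Icc]
    constructor <;> linarith [h₁.1, h₁.2, h₂.1, h₂.2]

theorem monotone_approx_index (x : E) : Monotone fun n => approx hE n c x := by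
  refine monotone_nat_of_le_succ fun n => ?_
  induction n generalizing c with
  | zero =>
    have h := (approx_mem_Icc_right_left hE c 0 x).2
    have h' : approx hE 0 (c.right hE) x = approx hE 0 c x := by simp only [approx, right_U]
    rw [show approx hE (0 + 1) c x = (approx hE 0 (c.left hE) x + approx hE 0 (c.right hE) x) / 2
      from rfl, h']
    linarith
  | succ n ih =>
    have h₁ := ih (c.left hE)
    have h₂ := ih (c.right hE)
    rw [approx, approx]
    linarith

/-- The limit of the approximations: an isotone continuous function with values in `[0, 1]` which
is `0` on `c.C` and `1` outside `c.U`. -/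
noncomputable def lim (x : E) : ℝ :=
  ⨆ n, approx hE n c x

theorem tendsto_approx (x : E) :
    Tendsto (fun n => approx hE n c x) atTop (𝓝 (c.lim hE x)) :=
  tendsto_atTop_ciSup (monotone_approx_index hE c x)
    ⟨1, fun _ ⟨n, hn⟩ => hn ▸ (approx_mem_Icc hE c n x).2⟩

theorem lim_of_mem_C {x : E} (hx : x ∈ c.C) : c.lim hE x = 0 := by
  simp only [lim, approx_of_mem_C hE c _ hx, ciSup_const]

theorem lim_of_notMem_U {x : E} (hx : x ∉ c.U) : c.lim hE x = 1 := by
  simp only [lim, approx_of_notMem_U hE c _ hx, ciSup_const]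

theorem lim_eq_half_add (x : E) :
    c.lim hE x = ((c.left hE).lim hE x + (c.right hE).lim hE x) / 2 :=
  tendsto_nhds_unique ((tendsto_add_atTop_iff_nat 1).2 (c.tendsto_approx hE x))
    ((((c.left hE).tendsto_approx hE x).add ((c.right hE).tendsto_approx hE x)).div_const 2)

theorem lim_mem_Icc (x : E) : c.lim hE x ∈ Icc (0 : ℝ) 1 :=
  isClosed_Icc.mem_of_tendsto (c.tendsto_approx hE x)
    (Eventually.of_forall fun n => approx_mem_Icc hE c n x)

theorem monotone_lim : Monotone (c.lim hE) := fun x y hxy =>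
  le_of_tendsto_of_tendsto' (c.tendsto_approx hE x) (c.tendsto_approx hE y)
    fun n => monotone_approx hE c n hxy

/-- The ratio `3 / 4` is the worse of two cases. On the open set `(c.left hE).U` the right half
vanishes, so oscillation is halved. Off it, the left-left quarter equals `1` near `x`, and the limit
is `1/4` plus `1/4` of the left-right limit plus `1/2` of the right one. -/
theorem continuous_lim : Continuous (c.lim hE) := by
  refine continuous_iff_continuousAt.2 fun x =>
    (Metric.nhds_basis_closedBall_pow (r := (3 / 4 : ℝ)) (by norm_num)
      (by norm_num)).tendsto_right_iff.2 fun n _ => ?_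
  simp only [Metric.mem_closedBall]
  induction n generalizing c with
  | zero =>
    filter_upwards with y
    rw [pow_zero]
    exact Real.dist_le_of_mem_Icc_01 (c.lim_mem_Icc hE _) (c.lim_mem_Icc hE _)
  | succ n ih =>
    have hr : (0 : ℝ) ≤ (3 / 4) ^ n := by positivity
    simp only [Real.dist_eq, abs_le] at ih ⊢
    by_cases hx : x ∈ (c.left hE).U
    · filter_upwards [(c.left hE).open_U.mem_nhds hx, ih (c.left hE)] with y hy hyd
      rw [pow_succ, c.lim_eq_half_add hE x, c.lim_eq_half_add hE y,
        lim_of_mem_C hE _ (c.left_U_subset_right_C hE hy),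
        lim_of_mem_C hE _ (c.left_U_subset_right_C hE hx)]
      constructor <;> linarith [hyd.1, hyd.2]
    · have hxC : x ∈ ((c.left hE).right hE).Cᶜ := fun h =>
        hx (((c.left hE).right_U hE).subset (((c.left hE).right hE).subset h))
      filter_upwards [((c.left hE).right hE).closed_C.isOpen_compl.mem_nhds hxC,
        ih ((c.left hE).right hE), ih (c.right hE)] with y hyC hyl hyr
      rw [pow_succ, c.lim_eq_half_add hE x, c.lim_eq_half_add hE y,
        (c.left hE).lim_eq_half_add hE x, (c.left hE).lim_eq_half_add hE y,
        lim_of_notMem_U hE _ fun h => hxC ((c.left hE).left_U_subset_right_C hE h),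
        lim_of_notMem_U hE _ fun h => hyC ((c.left hE).left_U_subset_right_C hE h)]
      constructor <;> linarith [hyl.1, hyl.2, hyr.1, hyr.2]

end LowerPair

/-! ### Countable families of isotone functions and a utility. -/

section Representation

variable {E : Type*} [TopologicalSpace E] [Preorder E]

/-- In a normally preordered space with a closed preorder, two points `x, y` with `¬ x ≤ y` are
told apart by an isotone continuous function. -/
theorem NormallyPreordered.exists_continuous_monotone_lt [OrderClosedTopology E]
    (hE : NormallyPreordered E) {x y : E} (hxy : ¬ x ≤ y) :
    ∃ f : E → ℝ, Continuous f ∧ Monotone f ∧ (∀ z, f z ∈ Icc (0 : ℝ) 1) ∧ f y < f x := by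
  let c : LowerPair E := ⟨Iic y, (Ici x)ᶜ, isClosed_Iic, isLowerSet_Iic y,
    isClosed_Ici.isOpen_compl, (isUpperSet_Ici x).compl,
    fun z hz hxz => hxy (le_trans hxz hz)⟩
  refine ⟨c.lim hE, c.continuous_lim hE, c.monotone_lim hE, c.lim_mem_Icc hE, ?_⟩
  rw [c.lim_of_mem_C hE (x := y) le_rfl, c.lim_of_notMem_U hE (x := x) fun h => h le_rfl]
  exact one_pos

/-- In a second-countable space, if isotone continuous functions determine the preorder, then
countably many of them do. -/
theorem exists_countable_monotone_representation [SecondCountableTopology E]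
    (h : ∀ x y : E, ¬ x ≤ y →
      ∃ f : E → ℝ, Continuous f ∧ Monotone f ∧ (∀ z, f z ∈ Icc (0 : ℝ) 1) ∧ f y < f x) :
    ∃ f : ℕ → E → ℝ, (∀ k, Continuous (f k)) ∧ (∀ k, Monotone (f k)) ∧
      (∀ k z, f k z ∈ Icc (0 : ℝ) 1) ∧ ∀ x y, ¬ x ≤ y → ∃ k, f k y < f k x := by
  let ι := {f : E → ℝ // Continuous f ∧ Monotone f ∧ ∀ z, f z ∈ Icc (0 : ℝ) 1}
  obtain ⟨T, hT, hTU⟩ := TopologicalSpace.isOpen_iUnion_countable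
    (fun f : ι => {p : E × E | f.1 p.2 < f.1 p.1})
    fun f => isOpen_lt (f.2.1.comp continuous_snd) (f.2.1.comp continuous_fst)
  -- Adjoined so that an enumeration by `ℕ` exists even if `T` is empty.
  let f₀ : ι := ⟨fun _ => 0, continuous_const, monotone_const, fun _ => by simp⟩
  obtain ⟨g, hg⟩ := (hT.insert f₀).exists_eq_range (insert_nonempty f₀ T)
  refine ⟨fun k => (g k).1, fun k => (g k).2.1, fun k => (g k).2.2.1, fun k => (g k).2.2.2,
    fun x y hxy => ?_⟩
  obtain ⟨f, hf₁, hf₂, hf₃, hf⟩ := h x y hxy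
  have hmem : (x, y) ∈ ⋃ f : ι, {p : E × E | f.1 p.2 < f.1 p.1} :=
    mem_iUnion.2 ⟨⟨f, hf₁, hf₂, hf₃⟩, hf⟩
  rw [← hTU] at hmem
  obtain ⟨f', hf', hlt⟩ := mem_iUnion₂.1 hmem
  obtain ⟨k, rfl⟩ : f' ∈ range g := hg ▸ mem_insert_of_mem f₀ hf'
  exact ⟨k, hlt⟩

/-- A countable family of isotone continuous functions that determines the preorder can be summed
to a continuous utility. -/
theorem exists_continuous_isUtility {f : ℕ → E → ℝ} (hc : ∀ k, Continuous (f k))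
    (hm : ∀ k, Monotone (f k)) (hI : ∀ k z, f k z ∈ Icc (0 : ℝ) 1)
    (hf : ∀ x y, ¬ x ≤ y → ∃ k, f k y < f k x) :
    ∃ g : E → ℝ, Continuous g ∧ IsUtility g ∧ ∀ z, g z ∈ Icc (0 : ℝ) 1 := by
  -- These weights sum to `1`, which keeps the sum in `[0, 1]`.
  have hpos : ∀ k : ℕ, (0 : ℝ) < 1 / 2 / 2 ^ k := fun k => by positivity
  have hle : ∀ k z, 1 / 2 / 2 ^ k * f k z ≤ 1 / 2 / 2 ^ k := fun k z =>
    mul_le_of_le_one_right (hpos k).le (hI k z).2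
  have hnn : ∀ k z, 0 ≤ 1 / 2 / 2 ^ k * f k z := fun k z => mul_nonneg (hpos k).le (hI k z).1
  have hs : ∀ z, Summable fun k => 1 / 2 / 2 ^ k * f k z := fun z =>
    (summable_geometric_two' 1).of_nonneg_of_le (fun k => hnn k z) fun k => hle k z
  have hmono : ∀ x y, x ≤ y → ∀ k, 1 / 2 / 2 ^ k * f k x ≤ 1 / 2 / 2 ^ k * f k y :=
    fun x y hxy k => mul_le_mul_of_nonneg_left (hm k hxy) (hpos k).le
  refine ⟨fun z => ∑' k, 1 / 2 / 2 ^ k * f k z, ?_, ⟨fun x y hxy => ?_, fun x y hxy hyx => ?_⟩,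
    fun z => ⟨tsum_nonneg fun k => hnn k z, ?_⟩⟩
  · refine continuous_tsum (fun k => continuous_const.mul (hc k)) (summable_geometric_two' 1)
      fun k z => ?_
    rw [Real.norm_of_nonneg (hnn k z)]
    exact hle k z
  · exact (hs x).tsum_le_tsum (hmono x y hxy) (hs y)
  · obtain ⟨k, hk⟩ := hf y x hyx
    exact (hs x).tsum_lt_tsum (hmono x y hxy) (mul_lt_mul_of_pos_left hk (hpos k)) (hs y)
  · exact ((hs z).tsum_le_tsum (fun k => hle k z) (summable_geometric_two' 1)).trans_eq
      (tsum_geometric_two' 1)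

end Representation

theorem mainTheorem1 {E : Type*} [TopologicalSpace E] [SecondCountableTopology E]
    [KOmegaSpace E] [Preorder E] [OrderClosedTopology E] :
    ∃ u : ℕ → E → ℝ,
      (∀ k, Continuous (u k)) ∧
      (∀ k, IsUtility (u k)) ∧
      (∀ k x, u k x ∈ Set.Icc (0 : ℝ) 1) ∧
      ∀ x y : E, x ≤ y ↔ ∀ k, u k x ≤ u k y := by
  obtain ⟨f, hc, hm, hI, hf⟩ := exists_countable_monotone_representation (E := E) fun _ _ hxy =>
    KOmegaSpace.normallyPreordered.exists_continuous_monotone_lt hxy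
  obtain ⟨g, hgc, hgu, hgI⟩ := exists_continuous_isUtility hc hm hI hf
  let w : ℕ → ℝ := fun n => 1 / ((n : ℝ) + 1)
  have hw₀ : ∀ n, 0 < w n := fun n => Nat.one_div_pos_of_nat
  have hw₁ : ∀ n, 0 ≤ 1 - w n := fun n =>
    sub_nonneg.2 ((div_le_one (by positivity)).2 (by simp))
  have hutil : ∀ k n, IsUtility fun z => (1 - w n) * f k z + w n * g z := fun k n =>
    ⟨fun x y hxy => add_le_add (mul_le_mul_of_nonneg_left (hm k hxy) (hw₁ n))
      (mul_le_mul_of_nonneg_left (hgu.isotone x y hxy) (hw₀ n).le),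
    fun x y hxy hyx => add_lt_add_of_le_of_lt (mul_le_mul_of_nonneg_left (hm k hxy) (hw₁ n))
      (mul_lt_mul_of_pos_left (hgu.strict x y hxy hyx) (hw₀ n))⟩
  -- The index `j` codes a pair `(k, n)`; fixing `k` and letting `n` grow recovers `f k`.
  refine ⟨fun j z => (1 - w j.unpair.2) * f j.unpair.1 z + w j.unpair.2 * g z,
    fun j => ((hc _).const_mul _).add (hgc.const_mul _), fun j => hutil _ _, fun j z => ?_,
    fun x y => ⟨fun hxy j => (hutil _ _).isotone x y hxy, fun h => ?_⟩⟩
  · exact convex_Icc (0 : ℝ) 1 (hI _ z) (hgI z) (hw₁ _) (hw₀ _).le (sub_add_cancel _ _)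
  · by_contra hxy
    obtain ⟨k, hk⟩ := hf x y hxy
    have hlim : ∀ z, Tendsto (fun n => (1 - w n) * f k z + w n * g z) atTop (𝓝 (f k z)) := by
      intro z
      have hw : Tendsto w atTop (𝓝 0) := tendsto_one_div_add_atTop_nhds_zero_nat
      simpa using ((hw.const_sub 1).mul_const (f k z)).add (hw.mul_const (g z))
    refine hk.not_ge (le_of_tendsto_of_tendsto' (hlim x) (hlim y) fun n => ?_)
    simpa using h (Nat.pair k n)
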